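/- Let $k$ be a field of characteristic zero, let $n\geq 1$, let $h_{n-1},\dots,h_1\in k[z]$ be polynomials and let $h_0\in k\smallsetminus\{0\}$ be a non-zero constant. Let $f\colon\mathbb N\to k$, where $\mathbb N=\{0,1,2,\dots\}$, be a sequence solution of the linear difference equation $\sigma^n(y)+h_{n-1}\sigma^{n-1}(y)+\dots+h_0y=0$, that is, $$f(i+n)+h_{n-1}(i)f(i+n-1)+\dots+h_1(i)f(i+1)+h_0f(i)=0\quad\text{for all sufficiently large } i\in\mathbb N.$$ Then the zero set $\{i\in\mathbb N \mid f(i)=0\}$ is a finite (possibly empty) union of arithmetic progressions. Here an arithmetic progression is a subset of $\mathbb N$ of the form $j+\mathbb N l$ with $j,l\in\mathbb N$; in particular ($l=0$) a one-element set is an arithmetic progression. -/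

import Mathlib

/-- An arithmetic progression is a subset of `ℕ` of the form `j + ℕ l` with `j, l ∈ ℕ`;
the period `l = 0` is allowed, so singletons are arithmetic progressions. -/
def IsArithProg (P : Set ℕ) : Prop :=
  ∃ j l : ℕ, P = {m : ℕ | ∃ t : ℕ, m = j + t * l}

/-- A subset of `ℕ` that is a finite (possibly empty) union of arithmetic progressions. -/
def IsFiniteUnionOfArithProgs (S : Set ℕ) : Prop :=
  ∃ A : Set (Set ℕ), A.Finite ∧ (∀ P ∈ A, IsArithProg P) ∧ S = ⋃₀ A

/-- `f : ℕ → k` is a sequence solution of the linear difference equation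
`σⁿ(y) + hₙ₋₁ σⁿ⁻¹(y) + ⋯ + h₀ y = 0` with polynomial coefficients, that is,
`f(i+n) + hₙ₋₁(i) f(i+n-1) + ⋯ + h₀(i) f(i) = 0` for all sufficiently large `i`. -/
def IsSequenceSolution {k : Type*} [Field k] {n : ℕ} (h : Fin n → Polynomial k)
    (f : ℕ → k) : Prop :=
  ∀ᶠ i : ℕ in Filter.atTop,
    f (i + n) + ∑ j : Fin n, (h j).eval (i : k) * f (i + (j : ℕ)) = 0

/-! This is a `p`-adic argument in the style of Skolem, Mahler and Lech. The coefficients, the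
initial values and the inverse of the trailing coefficient generate a finitely generated domain,
which embeds into a finite free `ℤ_[p]`-algebra for some `p ≥ 3`
(`exists_injective_ringHom_finite_free`). The trailing coefficient is a constant unit, so the
companion matrix is invertible modulo `p` at every point.

Hence for a suitable `M`, advancing by `M` steps multiplies the state vector at `j + M m` by `1 + p
Q(m)`. Choosing `p² ∣ M` makes `Q` vary so slowly with `m` that the `r`-th differences of `m ↦ f (j
+ M m)` are divisible by `p ^ r` (`exists_period_diffDiv`). In each coordinate, the coefficients of
Newton's expansion in falling factorials then tend to `0`, and a Strassmann-type bound
(`card_natural_zeros_le_of_norm_lt`) shows that the sequence is zero or has finitely many zeros. So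
each residue class modulo `M` contributes a full progression or a finite set. -/

/-! ### Zeros of `p`-adic Newton series -/

open Polynomial in
/-- A series `∑ dᵣ x(x-1)⋯(x-r+1)` over a nonarchimedean field, whose coefficients beyond the
`N`-th one are smaller than the `N`-th one, has at most `N` zeros in `ℕ`. -/
theorem card_natural_zeros_le_of_norm_lt {p : ℕ} [Fact p.Prime] (d : ℕ → ℚ_[p]) {N : ℕ}
    (hN : ∀ r, N < r → ‖d r‖ < ‖d N‖) (s : Finset ℕ)
    (hs : ∀ x ∈ s, ∑ r ∈ Finset.range (x + 1), (x.descFactorial r : ℚ_[p]) * d r = 0) :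
    s.card ≤ N ∨ d N = 0 := by
  by_contra! hcon
  obtain ⟨hcard, hdN⟩ := hcon
  obtain ⟨s, hss, hsc⟩ := Finset.exists_subset_card_eq (Nat.succ_le_of_lt hcard)
  replace hs : ∀ x ∈ s, _ := fun x hx => hs x (hss hx)
  set W : ℤ[X] := ∏ x ∈ s, (X - C (x : ℤ)) with hW
  have hWm : W.Monic := monic_prod_of_monic _ _ fun x _ => monic_X_sub_C _
  have hWd : W.degree = (N + 1 : ℕ) := by
    simp only [hW, degree_prod, degree_X_sub_C]
    simp [hsc]
  -- Reducing modulo the monic `W` keeps the values on `s` and integral coefficients, while bringing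
  -- the degree down to at most `N`. So a combination of the `P r` vanishing on the `N + 1` points
  -- of `s` is zero.
  set P : ℕ → ℤ[X] := fun r => descPochhammer ℤ r %ₘ W with hP
  have hPeval (r x : ℕ) (hx : x ∈ s) : (P r).eval (x : ℤ) = x.descFactorial r := by
    have h1 := congrArg (eval (x : ℤ)) (modByMonic_add_div (descPochhammer ℤ r) W)
    have h2 : W.eval (x : ℤ) = 0 := by
      rw [hW, eval_prod]; exact Finset.prod_eq_zero hx (by simp)
    rw [descPochhammer_eval_eq_descFactorial] at h1
    simpa [h2] using h1
  have hPlow (r : ℕ) (hr : r ≤ N) : P r = descPochhammer ℤ r := by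
    rw [hP]
    refine (modByMonic_eq_self_iff hWm).2 ?_
    rw [hWd, degree_eq_natDegree (monic_descPochhammer ℤ r).ne_zero, descPochhammer_natDegree]
    exact_mod_cast Nat.lt_succ_of_le hr
  have hPdeg (r : ℕ) : (P r).degree < (N + 1 : ℕ) := hWd ▸ degree_modByMonic_lt _ hWm
  set R := s.sup id + N + 1 with hR
  set Q : ℚ_[p][X] :=
    ∑ r ∈ Finset.range R, C (d r) * (P r).map (Int.castRingHom ℚ_[p]) with hQ
  have hQ0 : Q = 0 := by
    have hinj : Set.InjOn (fun x : ℕ => (x : ℚ_[p])) s := fun a _ b _ h => Nat.cast_injective h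
    refine eq_zero_of_degree_lt_of_eval_index_eq_zero s hinj ?_ ?_
    · rw [hsc]
      refine (degree_sum_le _ _).trans_lt ?_
      rw [Finset.sup_lt_iff (by exact WithBot.bot_lt_coe _)]
      intro r _
      refine lt_of_le_of_lt ?_ (hPdeg r)
      rw [← smul_eq_C_mul]
      exact (degree_smul_le _ _).trans degree_map_le
    · intro x hx
      rw [← hs x hx, hQ, eval_finsetSum]
      have hxR : x + 1 ≤ R := by
        have := Finset.le_sup (f := id) hx
        simp only [id] at this; omega
      rw [← Finset.sum_subset (Finset.range_mono hxR)]
      · refine Finset.sum_congr rfl fun r _ => ?_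
        have := congrArg (Int.castRingHom ℚ_[p]) (hPeval r x hx)
        rw [← eval₂_at_apply, ← eval_map] at this
        simp only [eval_mul, eval_C]
        simp only [eq_intCast, Int.cast_natCast] at this
        rw [this]; ring
      · intro r _ hr
        have := congrArg (Int.castRingHom ℚ_[p]) (hPeval r x hx)
        rw [← eval₂_at_apply, ← eval_map, Nat.descFactorial_of_lt (by simpa using hr)] at this
        simp only [eq_intCast, Int.cast_natCast, Nat.cast_zero] at this
        simp [this]
  -- Compare coefficients of `X ^ N`: indices below `N` give nothing by degree, `N` gives `d N`, and
  -- larger `r` give integer multiples of `d r`, too small to cancel `d N` in an ultrametric norm.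
  have hcoef := congrArg (fun q : ℚ_[p][X] => q.coeff N) hQ0
  simp only [hQ, finsetSum_coeff, coeff_C_mul, coeff_map, coeff_zero, eq_intCast] at hcoef
  rw [← Finset.add_sum_erase _ _ (Finset.mem_range.2 (by omega : N < R))] at hcoef
  have hNN : (P N).coeff N = 1 := by
    have := (monic_descPochhammer ℤ N).coeff_natDegree
    rwa [descPochhammer_natDegree, ← hPlow N le_rfl] at this
  rw [hNN, Int.cast_one, mul_one, add_eq_zero_iff_eq_neg] at hcoef
  have hlt : ‖d N‖ < ‖d N‖ := by
    conv_lhs => rw [hcoef, norm_neg]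
    have hpos : 0 < ‖d N‖ := norm_pos_iff.2 hdN
    refine lt_of_not_ge fun hge => ?_
    obtain ⟨r, hr, hle⟩ :=
      IsUltrametricDist.exists_norm_finsetSum_le ((Finset.range R).erase N)
        (fun r => d r * (((P r).coeff N : ℤ) : ℚ_[p]))
    have hne : ((Finset.range R).erase N).Nonempty := by
      by_contra hem
      rw [Finset.not_nonempty_iff_eq_empty] at hem
      rw [hem, Finset.sum_empty, norm_zero] at hge
      linarith
    have hr' := hr hne
    have h3 := hge.trans hle
    rw [norm_mul] at h3
    rcases lt_or_gt_of_ne (Finset.ne_of_mem_erase hr') with h | h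
    · rw [hPlow r h.le, coeff_eq_zero_of_natDegree_lt (by rwa [descPochhammer_natDegree])] at h3
      simp at h3
      exact hdN h3
    · have := hN r h
      have h4 : ‖(((P r).coeff N : ℤ) : ℚ_[p])‖ ≤ 1 := Padic.norm_int_le_one _
      nlinarith [norm_nonneg (d r)]
  exact lt_irrefl _ hlt

/-- Legendre's formula gives `(p - 1) v_p(r!) ≤ r`. With `p ≥ 3` the factorial eats at most half of
the divisibility by `p ^ r`; for `p = 2` nearly all of it can be lost. -/
theorem padic_norm_factorial_ge {p : ℕ} [hp : Fact p.Prime] (hp3 : 3 ≤ p) (r : ℕ) :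
    (p : ℝ) ^ (-(r / 2 : ℝ)) ≤ ‖(r.factorial : ℚ_[p])‖ := by
  have h1 := sub_one_mul_padicValNat_factorial (p := p) r
  have h2 : 2 * padicValNat p r.factorial ≤ r := by
    have : 2 * padicValNat p r.factorial ≤ (p - 1) * padicValNat p r.factorial :=
      Nat.mul_le_mul_right _ (by omega)
    omega
  have h3 : (r.factorial : ℚ_[p]) ≠ 0 := by exact_mod_cast r.factorial_ne_zero
  rw [Padic.norm_eq_zpow_neg_valuation h3, Padic.valuation_natCast, ← Real.rpow_intCast]
  refine Real.rpow_le_rpow_of_exponent_le (by exact_mod_cast hp.out.one_le) ?_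
  have : (2 : ℝ) * padicValNat p r.factorial ≤ r := by exact_mod_cast h2
  rw [Int.cast_neg, Int.cast_natCast]
  linarith

theorem padic_norm_div_factorial_tendsto_zero {p : ℕ} [hp : Fact p.Prime] (hp3 : 3 ≤ p)
    (b : ℕ → ℚ_[p]) (hb : ∀ r, ‖b r‖ ≤ (p : ℝ) ^ (-(r : ℝ))) :
    Filter.Tendsto (fun r => ‖b r / r.factorial‖) Filter.atTop (nhds 0) := by
  have hp0 : (0 : ℝ) < p := by exact_mod_cast hp.out.pos
  have hbound (r : ℕ) : ‖b r / r.factorial‖ ≤ ((p : ℝ) ^ (-(1 / 2) : ℝ)) ^ r := by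
    have h3 : (r.factorial : ℚ_[p]) ≠ 0 := by exact_mod_cast r.factorial_ne_zero
    rw [norm_div, div_le_iff₀ (norm_pos_iff.2 h3)]
    refine (hb r).trans ?_
    calc (p : ℝ) ^ (-(r : ℝ)) = ((p : ℝ) ^ (-(1 / 2) : ℝ)) ^ r * (p : ℝ) ^ (-(r / 2 : ℝ)) := by
          rw [← Real.rpow_mul_natCast hp0.le, ← Real.rpow_add hp0]; congr 1; ring
      _ ≤ _ := by
          gcongr
          exact padic_norm_factorial_ge hp3 r
  refine squeeze_zero (fun _ => norm_nonneg _) hbound ?_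
  refine tendsto_pow_atTop_nhds_zero_of_lt_one (by positivity) ?_
  exact Real.rpow_lt_one_of_one_lt_of_neg (by exact_mod_cast hp.out.one_lt) (by norm_num)

/-- A sequence of `p`-adic integers whose `r`-th differences at `0` are divisible by `p ^ r`
vanishes identically or has only finitely many zeros. -/
theorem finite_zeros_of_pow_dvd_fwdDiff {p : ℕ} [hp : Fact p.Prime] (hp3 : 3 ≤ p)
    (a : ℕ → ℤ_[p]) (ha : ∀ r, (p : ℤ_[p]) ^ r ∣ (fwdDiff 1)^[r] a 0) :
    (∀ m, a m = 0) ∨ {m | a m = 0}.Finite := by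
  set b : ℕ → ℚ_[p] := fun r => ((fwdDiff 1)^[r] a 0 : ℤ_[p]) with hbdef
  have hb (r : ℕ) : ‖b r‖ ≤ (p : ℝ) ^ (-(r : ℝ)) := by
    have := (PadicInt.norm_le_pow_iff_mem_span_pow ((fwdDiff 1)^[r] a 0) r).2
      (Ideal.mem_span_singleton.2 (ha r))
    rw [← Real.rpow_intCast] at this
    simpa [hbdef] using this
  have hlim := padic_norm_div_factorial_tendsto_zero hp3 b hb
  set d : ℕ → ℚ_[p] := fun r => b r / r.factorial with hd
  have hsum (m : ℕ) : (a m : ℚ_[p]) =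
      ∑ r ∈ Finset.range (m + 1), (m.descFactorial r : ℚ_[p]) * d r := by
    have := shift_eq_sum_fwdDiff_iter 1 a m 0
    simp only [smul_eq_mul, mul_one, zero_add] at this
    rw [this, PadicInt.coe_sum]
    refine Finset.sum_congr rfl fun r _ => ?_
    have h3 : (r.factorial : ℚ_[p]) ≠ 0 := by exact_mod_cast r.factorial_ne_zero
    rw [Nat.descFactorial_eq_factorial_mul_choose, hd, hbdef]
    push_cast
    field_simp
    simp
  by_cases hall : ∀ r, d r = 0
  · left
    intro m
    have : (a m : ℚ_[p]) = 0 := by rw [hsum]; simp [hall]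
    exact PadicInt.coe_eq_zero.1 this
  right
  push Not at hall
  obtain ⟨r₀, hr₀⟩ := hall
  have hpos : 0 < ‖d r₀‖ := norm_pos_iff.2 hr₀
  obtain ⟨K, hK⟩ := Filter.eventually_atTop.1 (hlim.eventually (gt_mem_nhds hpos))
  -- `N` will be the last index whose coefficient is at least as large as the nonzero `d r₀`; all
  -- later ones are strictly smaller than `d N`.
  have hfin : {r | ‖d r₀‖ ≤ ‖d r‖}.Finite :=
    (Set.finite_lt_nat K).subset fun r hr => by
      by_contra h
      exact absurd (hK r (by simpa using h)) (not_lt.2 hr)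
  obtain ⟨N, hNmem, hNmax⟩ := Set.exists_max_image _ id hfin ⟨r₀, le_refl ‖d r₀‖⟩
  have hN : ∀ r, N < r → ‖d r‖ < ‖d N‖ := fun r hr => by
    refine lt_of_lt_of_le (lt_of_not_ge fun h => ?_) hNmem
    exact absurd (hNmax r h) (not_le.2 hr)
  by_contra hinf
  obtain ⟨s, hss, hsc⟩ := Set.Infinite.exists_subset_card_eq hinf (N + 1)
  rcases card_natural_zeros_le_of_norm_lt d hN s
    (fun x hx => by rw [← hsum, show a x = 0 from hss hx]; simp) with h | h
  · omega
  · rw [Set.mem_ofPred_eq, h, norm_zero] at hNmem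
    linarith

/-! ### Sequences with highly divisible differences -/

/-- The first `r` iterated differences of `F` are divisible by `q, q², …, qʳ` (with quotients chosen
coherently, so that the notion makes sense in every commutative ring). -/
def DiffDiv {T : Type*} [CommRing T] (q : T) : ℕ → (ℕ → T) → Prop
  | 0, _ => True
  | r + 1, F => ∃ F' : ℕ → T, DiffDiv q r F' ∧ ∀ m, F (m + 1) = F m + q * F' m

namespace DiffDiv

variable {T : Type*} [CommRing T] {q : T}

theorem const (q c : T) (r : ℕ) : DiffDiv q r (fun _ => c) := by
  induction r generalizing c with
  | zero => trivial
  | succ r ih => exact ⟨fun _ => 0, ih 0, by simp⟩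

theorem of_succ {r : ℕ} {F : ℕ → T} (h : DiffDiv q (r + 1) F) : DiffDiv q r F := by
  induction r generalizing F with
  | zero => trivial
  | succ r ih =>
    obtain ⟨F', hF', h⟩ := h
    exact ⟨F', ih hF', h⟩

theorem add {r : ℕ} {F G : ℕ → T} (hF : DiffDiv q r F) (hG : DiffDiv q r G) :
    DiffDiv q r (fun m => F m + G m) := by
  induction r generalizing F G with
  | zero => trivial
  | succ r ih =>
    obtain ⟨F', hF', hF⟩ := hF
    obtain ⟨G', hG', hG⟩ := hG
    exact ⟨_, ih hF' hG', fun m => by simp only [hF, hG]; ring⟩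

theorem shift {r : ℕ} {F : ℕ → T} (hF : DiffDiv q r F) : DiffDiv q r (fun m => F (m + 1)) := by
  induction r generalizing F with
  | zero => trivial
  | succ r ih =>
    obtain ⟨F', hF', hF⟩ := hF
    exact ⟨_, ih hF', fun m => hF (m + 1)⟩

/-- Discrete Leibniz rule: the quotient for `F G` is `F' G` plus the shift of `F` times `G'`. -/
theorem mul {r : ℕ} {F G : ℕ → T} (hF : DiffDiv q r F) (hG : DiffDiv q r G) :
    DiffDiv q r (fun m => F m * G m) := by
  induction r generalizing F G with
  | zero => trivial
  | succ r ih =>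
    have hF₀ := hF.shift.of_succ
    have hG₀ := hG.of_succ
    obtain ⟨F', hF', hF⟩ := hF
    obtain ⟨G', hG', hG⟩ := hG
    exact ⟨_, (ih hF' hG₀).add (ih hF₀ hG'), fun m => by simp only [hF, hG]; ring⟩

theorem sum {ι : Type*} {r : ℕ} (s : Finset ι) {F : ι → ℕ → T}
    (hF : ∀ i ∈ s, DiffDiv q r (F i)) : DiffDiv q r (fun m => ∑ i ∈ s, F i m) := by
  classical
  induction s using Finset.induction_on with
  | empty => simpa using const q 0 r
  | insert i s hi ih =>
    simp only [Finset.sum_insert hi]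
    exact (hF i (Finset.mem_insert_self i s)).add
      (ih fun j hj => hF j (Finset.mem_insert_of_mem hj))

theorem linear (c e : T) (r : ℕ) : DiffDiv q r (fun m => c + m * (q * e)) := by
  cases r with
  | zero => trivial
  | succ r => exact ⟨fun _ => e, const q e r, fun m => by push_cast; ring⟩

theorem polynomial_eval {r : ℕ} {F : ℕ → T} (hF : DiffDiv q r F) (P : Polynomial T) :
    DiffDiv q r (fun m => P.eval (F m)) := by
  induction P using Polynomial.induction_on' with
  | add P Q hP hQ => simpa using hP.add hQ
  | monomial n c =>
    induction n with
    | zero => simpa using const q c r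
    | succ n ih => simpa [pow_succ, mul_assoc] using ih.mul hF

theorem mono_sq {p : T} {r : ℕ} {F : ℕ → T} (hF : DiffDiv (p ^ 2) r F) : DiffDiv p r F := by
  induction r generalizing F with
  | zero => trivial
  | succ r ih =>
    obtain ⟨F', hF', hF⟩ := hF
    exact ⟨_, (const p p r).mul (ih hF'), fun m => by rw [hF]; ring⟩

/-- If `c + p Q` has differences divisible by powers of `p²`, then `Q` has differences
divisible by powers of `p`. -/
theorem of_const_add_mul {p : T} (hp : IsLeftRegular p) {r : ℕ} {Q : ℕ → T} {c : T}
    (h : DiffDiv (p ^ 2) r (fun m => c + p * Q m)) : DiffDiv p r Q := by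
  cases r with
  | zero => trivial
  | succ r =>
    obtain ⟨F', hF', h⟩ := h
    -- Dividing by `p` costs one factor, at the first difference only: `p²` becomes `p` there, and
    -- the later levels are merely weakened from `p²` to `p`.
    refine ⟨F', hF'.mono_sq, fun m => hp ?_⟩
    have := h m
    simp only
    linear_combination this

theorem pow_dvd_fwdDiff_iter {r : ℕ} {F : ℕ → T} (hF : DiffDiv q r F) (m : ℕ) :
    q ^ r ∣ (fwdDiff 1)^[r] F m := by
  induction r generalizing F with
  | zero => simp
  | succ r ih =>
    obtain ⟨F', hF', hF⟩ := hF
    have : fwdDiff 1 F = q • F' := by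
      ext m; simp [fwdDiff, hF m]
    rw [Function.iterate_succ_apply, this, fwdDiff_iter_const_smul, pow_succ']
    exact mul_dvd_mul_left q (ih hF')

/-- Solutions of `g (m + 1) = (1 + p Q m) g m` have differences divisible by powers of `p`. -/
theorem of_linear_system {p : T} {ι : Type*} [Fintype ι] {Q : ℕ → Matrix ι ι T}
    (hQ : ∀ r a b, DiffDiv p r (fun m => Q m a b)) {g : ℕ → ι → T}
    (hg : ∀ m a, g (m + 1) a = g m a + p * ∑ b, Q m a b * g m b) (r : ℕ) (a : ι) :
    DiffDiv p r (fun m => g m a) := by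
  induction r generalizing a with
  | zero => trivial
  | succ r ih =>
    -- The recursion itself exhibits the difference quotient as `Q g`, so `r` levels for `g` yield
    -- `r + 1`.
    exact ⟨_, sum Finset.univ fun b _ => (hQ r a b).mul (ih b), fun m => hg m a⟩

end DiffDiv

/-! ### Matrix products along the recurrence -/

section Transition

variable {T : Type*} [CommRing T] {ι : Type*} [Fintype ι] [DecidableEq ι]

/-- The product `A(x+s-1) ⋯ A(x+1) A(x)` for a matrix of polynomials `A`. -/
def transition (A : Matrix ι ι (Polynomial T)) (x : T) : ℕ → Matrix ι ι T
  | 0 => 1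
  | s + 1 => A.map (Polynomial.eval (x + s)) * transition A x s

theorem transition_add (A : Matrix ι ι (Polynomial T)) (x : T) (s t : ℕ) :
    transition A x (s + t) = transition A (x + s) t * transition A x s := by
  induction t with
  | zero => simp [transition]
  | succ t ih =>
    rw [← add_assoc, transition, transition, ih, Matrix.mul_assoc]
    push_cast
    rw [add_assoc]

theorem map_transition {T' : Type*} [CommRing T'] (π : T →+* T')
    (A : Matrix ι ι (Polynomial T)) (x : T) (s : ℕ) :
    (transition A x s).map π = transition (A.map (Polynomial.map π)) (π x) s := by
  induction s with
  | zero => simp [transition]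
  | succ s ih =>
    rw [transition, transition, Matrix.map_mul, ih]
    congr 1
    ext a b
    simp only [Matrix.map_apply]
    rw [← map_natCast π, ← map_add, Polynomial.eval_map, Polynomial.eval₂_at_apply]

theorem isLeftRegular_transition {A : Matrix ι ι (Polynomial T)}
    (hA : ∀ x, IsLeftRegular (A.map (Polynomial.eval x))) (x : T) (s : ℕ) :
    IsLeftRegular (transition A x s) := by
  induction s with
  | zero => exact isRegular_one.left
  | succ s ih => exact (hA _).mul ih

/-- When `p = 0` in `T`, the matrices repeat with period `p`, so the product splits into equal
blocks. -/
theorem transition_mul_of_cast_eq_zero (A : Matrix ι ι (Polynomial T)) {p : ℕ}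
    (hp : (p : T) = 0) (x : T) (t : ℕ) : transition A x (p * t) = transition A x p ^ t := by
  induction t with
  | zero => simp [transition]
  | succ t ih =>
    rw [Nat.mul_succ, transition_add, ih, pow_succ']
    simp [hp]

/-- Over a finite ring, left regular matrices are units; `N` is the order of the unit group. The
free factor `c` leaves room for an extra `p` in the period. -/
theorem exists_transition_eq_one [Finite T] {A : Matrix ι ι (Polynomial T)}
    (hA : ∀ x, IsLeftRegular (A.map (Polynomial.eval x))) {p : ℕ} (hp : (p : T) = 0) :
    ∃ N, 0 < N ∧ ∀ (x : T) (c : ℕ), transition A x (p * (c * N)) = 1 := by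
  have : Finite (Matrix ι ι T) := Pi.finite
  refine ⟨Nat.card (Matrix ι ι T)ˣ, Nat.card_pos, fun x c => ?_⟩
  obtain ⟨u, hu⟩ : IsUnit (transition A x p) :=
    (isLeftRegular_transition hA x p).isUnit_of_finite
  rw [transition_mul_of_cast_eq_zero A hp, mul_comm, pow_mul, ← hu, ← Units.val_pow_eq_pow_val,
    pow_card_eq_one']
  simp

theorem DiffDiv.transition {q : T} (A : Matrix ι ι (Polynomial T)) {F : ℕ → T} {r : ℕ}
    (hF : DiffDiv q r F) (s : ℕ) (a b : ι) :
    DiffDiv q r (fun m => transition A (F m) s a b) := by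
  induction s generalizing a b with
  | zero => exact DiffDiv.const _ _ _
  | succ s ih =>
    simp only [_root_.transition, Matrix.mul_apply, Matrix.map_apply]
    exact DiffDiv.sum _ fun c _ => ((hF.add (DiffDiv.const q (s : T) r)).polynomial_eval _).mul
      (ih c b)

theorem transition_mulVec (A : Matrix ι ι (Polynomial T)) {v : ℕ → ι → T}
    (hv : ∀ i : ℕ, v (i + 1) = (A.map (Polynomial.eval (i : T))).mulVec (v i)) (i s : ℕ) :
    v (i + s) = (transition A (i : T) s).mulVec (v i) := by
  induction s with
  | zero => simp [transition]
  | succ s ih =>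
    rw [← add_assoc, hv, ih, transition, Matrix.mulVec_mulVec]
    push_cast
    rfl

theorem exists_period_diffDiv {p : ℕ} (hp0 : 0 < p) (hp : IsLeftRegular (p : T))
    [Finite (T ⧸ Ideal.span {(p : T)})] (A : Matrix ι ι (Polynomial T))
    (hA : ∀ x, IsLeftRegular ((A.map (Polynomial.map
      (Ideal.Quotient.mk (Ideal.span {(p : T)})))).map (Polynomial.eval x))) :
    ∃ M, 0 < M ∧ ∀ v : ℕ → ι → T,
      (∀ i : ℕ, v (i + 1) = (A.map (Polynomial.eval (i : T))).mulVec (v i)) →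
      ∀ (j r : ℕ) (a : ι), DiffDiv (p : T) r (fun m => v (j + M * m) a) := by
  set π := Ideal.Quotient.mk (Ideal.span {(p : T)}) with hπ
  have hπp : ((p : ℕ) : T ⧸ Ideal.span {(p : T)}) = 0 := by
    rw [← map_natCast π, hπ]
    exact Ideal.Quotient.eq_zero_iff_mem.2 (Ideal.mem_span_singleton_self _)
  obtain ⟨N, hN, h1⟩ := exists_transition_eq_one hA hπp
  -- One `p` and `N` make the transition trivial modulo `p`. The other `p` makes the base point `j +
  -- M m` move in multiples of `p²`, which pays for dividing by `p` to obtain `Q`.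
  set M := p * (p * N) with hM
  refine ⟨M, by positivity, fun v hv j => ?_⟩
  have hdvd (m : ℕ) (a b : ι) : ∃ c : T,
      transition A ((j + M * m : ℕ) : T) M a b = (1 : Matrix ι ι T) a b + p * c := by
    have h2 := congrFun (congrFun (map_transition π A ((j + M * m : ℕ) : T) M) a) b
    rw [h1 _ p] at h2
    have h3 : π (transition A ((j + M * m : ℕ) : T) M a b - (1 : Matrix ι ι T) a b) = 0 := by
      rw [map_sub, sub_eq_zero]
      refine h2.trans ?_
      simp [Matrix.one_apply, apply_ite π]
    obtain ⟨c, hc⟩ := Ideal.mem_span_singleton.1 (Ideal.Quotient.eq_zero_iff_mem.1 h3)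
    exact ⟨c, by rw [← hc]; ring⟩
  choose Q hQ using hdvd
  refine DiffDiv.of_linear_system (Q := Q) (fun r a b => ?_) (fun m a => ?_)
  · refine DiffDiv.of_const_add_mul hp (c := (1 : Matrix ι ι T) a b) ?_
    simp only [← hQ]
    have := (DiffDiv.linear (q := (p : T) ^ 2) (j : T) (N : T) r).transition A M a b
    convert this using 6
    rw [hM]; push_cast; ring
  · rw [Nat.mul_succ, ← add_assoc, transition_mulVec A hv (j + M * m) M]
    simp only [Matrix.mulVec, dotProduct, hQ, add_mul, Finset.sum_add_distrib]
    simp [Matrix.one_apply, Finset.mul_sum, mul_assoc]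

end Transition

/-! ### Companion matrices and the `p`-adic case -/

/-- The companion matrix of the operator `σⁿ + hₙ₋₁ σⁿ⁻¹ + ⋯ + h₀`. -/
def companionMatrix {R : Type*} [CommRing R] {n : ℕ} (h : Fin n → R) : Matrix (Fin n) (Fin n) R :=
  Matrix.of fun a b => if (a : ℕ) + 1 < n then (if (b : ℕ) = a + 1 then 1 else 0) else -h b

theorem companionMatrix_map {R R' : Type*} [CommRing R] [CommRing R'] {n : ℕ} (h : Fin n → R)
    (φ : R →+* R') : (companionMatrix h).map φ = companionMatrix (fun b => φ (h b)) := by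
  ext a b
  simp only [companionMatrix, Matrix.map_apply, Matrix.of_apply]
  split_ifs <;> simp

theorem companionMatrix_mul_of_lt {R : Type*} [CommRing R] {n : ℕ} (h : Fin n → R)
    {κ : Type*} (Y : Matrix (Fin n) κ R) (a : Fin n) (ha : (a : ℕ) + 1 < n) (c : κ) :
    (companionMatrix h * Y) a c = Y ⟨a + 1, ha⟩ c := by
  rw [Matrix.mul_apply, Finset.sum_eq_single ⟨a + 1, ha⟩]
  · simp [companionMatrix, ha]
  · intro b _ hb
    have : (b : ℕ) ≠ a + 1 := fun h => hb (Fin.ext h)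
    simp [companionMatrix, ha, this]
  · simp

/-- All rows but the last shift coordinates, which determines every row of the right factor except
row `0`; the last row then recovers that one because its coefficient is a unit. -/
theorem isLeftRegular_companionMatrix {R : Type*} [CommRing R] {n : ℕ} (hn : 0 < n)
    (h : Fin n → R) (h0 : IsUnit (h ⟨0, hn⟩)) : IsLeftRegular (companionMatrix h) := by
  intro Y Z hYZ
  have hpos (b : Fin n) (hb : b ≠ ⟨0, hn⟩) (c : Fin n) : Y b c = Z b c := by
    obtain ⟨b, hbn⟩ := b
    cases b with
    | zero => exact absurd rfl hb
    | succ b =>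
      have := congrFun (congrFun hYZ ⟨b, by omega⟩) c
      simp only at this
      rwa [companionMatrix_mul_of_lt h Y _ hbn, companionMatrix_mul_of_lt h Z _ hbn] at this
  ext b c
  by_cases hb : b = ⟨0, hn⟩
  · have := congrFun (congrFun hYZ ⟨n - 1, by omega⟩) c
    simp only [Matrix.mul_apply] at this
    rw [← Finset.add_sum_erase _ _ (Finset.mem_univ (⟨0, hn⟩ : Fin n)),
      ← Finset.add_sum_erase _ _ (Finset.mem_univ (⟨0, hn⟩ : Fin n)),
      Finset.sum_congr rfl fun b hb => by rw [hpos b (Finset.ne_of_mem_erase hb) c]] at this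
    have h2 := add_right_cancel this
    have hlast : ¬ (n - 1 + 1 < n) := by omega
    simp only [companionMatrix, Matrix.of_apply, hlast, if_false, neg_mul, neg_inj] at h2
    rw [hb]
    exact h0.mul_left_cancel h2
  · exact hpos b hb c

theorem companionMatrix_mulVec {R : Type*} [CommRing R] {n : ℕ} (h : Fin n → R) {f : ℕ → R}
    {i : ℕ} (hf : f (i + n) + ∑ j : Fin n, h j * f (i + j) = 0) (a : Fin n) :
    f (i + 1 + a) = (companionMatrix h).mulVec (fun b => f (i + b)) a := by
  rw [Matrix.mulVec, dotProduct]
  by_cases ha : (a : ℕ) + 1 < n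
  · rw [Finset.sum_eq_single ⟨a + 1, ha⟩]
    · simp [companionMatrix, ha, add_assoc, add_comm 1]
    · intro b _ hb
      have : (b : ℕ) ≠ a + 1 := fun h => hb (Fin.ext h)
      simp [companionMatrix, ha, this]
    · simp
  · simp only [companionMatrix, Matrix.of_apply, ha, if_false, neg_mul, Finset.sum_neg_distrib]
    rw [← eq_neg_of_add_eq_zero_left hf]
    congr 1
    have := a.isLt
    omega

/-- Over a finite free `ℤ_[p]`-algebra, the zeros of a solution of a linear recurrence with
polynomial coefficients and unit trailing coefficient are, along each residue class modulo a
suitable `M`, finite in number or everything. -/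
theorem exists_period_zeros {p : ℕ} [hp : Fact p.Prime] (hp3 : 3 ≤ p) {T : Type*} [CommRing T]
    [Algebra ℤ_[p] T] [Module.Finite ℤ_[p] T] [Module.Free ℤ_[p] T] {n : ℕ} (hn : 0 < n)
    (h : Fin n → Polynomial T) {c : T} (hc : IsUnit c) (h0 : h ⟨0, hn⟩ = Polynomial.C c)
    (f : ℕ → T)
    (hf : ∀ i : ℕ, f (i + n) + ∑ j : Fin n, (h j).eval (i : T) * f (i + (j : ℕ)) = 0) :
    ∃ M, 0 < M ∧ ∀ j, (∀ m, f (j + M * m) = 0) ∨ {m | f (j + M * m) = 0}.Finite := by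
  let B := Module.Free.chooseBasis ℤ_[p] T
  have hcast (m : ℕ) (x : T) : (m : T) * x = (m : ℤ_[p]) • x := by
    rw [Algebra.smul_def, map_natCast]
  have hpT : IsLeftRegular (p : T) := by
    intro x y hxy
    simp only [hcast] at hxy
    refine B.ext_elem fun i => ?_
    have := congrArg (fun z => B.repr z i) hxy
    simp only [map_smul, Finsupp.smul_apply, smul_eq_mul] at this
    exact mul_left_cancel₀ (by exact_mod_cast hp.out.ne_zero) this
  -- In a basis, each coordinate can be reduced modulo `p` to a digit in `Fin p`.
  have hfin : Finite (T ⧸ Ideal.span {(p : T)}) := by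
    have hrepr (z : ℤ_[p]) : ∃ (d : Fin p) (w : ℤ_[p]), z = (d : ℕ) + p * w := by
      have h2 := PadicInt.sub_zmodRepr_mem (x := z)
      rw [PadicInt.maximalIdeal_eq_span_p, Ideal.mem_span_singleton] at h2
      obtain ⟨w, hw⟩ := h2
      exact ⟨⟨_, PadicInt.zmodRepr_lt_p z⟩, w, by rw [← hw]; ring⟩
    choose d w hdw using hrepr
    refine Finite.of_surjective (fun g : Module.Free.ChooseBasisIndex ℤ_[p] T → Fin p =>
      Ideal.Quotient.mk (Ideal.span {(p : T)}) (∑ i, ((g i : ℕ) : ℤ_[p]) • B i)) fun z => ?_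
    obtain ⟨z, rfl⟩ := Ideal.Quotient.mk_surjective z
    refine ⟨fun i => d (B.repr z i), ?_⟩
    rw [eq_comm, Ideal.Quotient.eq, Ideal.mem_span_singleton]
    refine ⟨∑ i, w (B.repr z i) • B i, ?_⟩
    refine (congrArg (· - _) (B.sum_repr z).symm).trans ?_
    rw [hcast, Finset.smul_sum, ← Finset.sum_sub_distrib]
    refine Finset.sum_congr rfl fun i _ => ?_
    rw [← sub_smul, smul_smul]
    congr 1
    exact sub_eq_of_eq_add' (hdw _)
  obtain ⟨M, hM, hper⟩ := exists_period_diffDiv hp.out.pos hpT (companionMatrix h) (fun x => by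
    have h1 := companionMatrix_map h
      (Polynomial.mapRingHom (Ideal.Quotient.mk (Ideal.span {(p : T)})))
    have h2 := companionMatrix_map (fun b => Polynomial.mapRingHom
      (Ideal.Quotient.mk (Ideal.span {(p : T)})) (h b)) (Polynomial.evalRingHom x)
    rw [← h1] at h2
    simp only [Polynomial.coe_mapRingHom, Polynomial.coe_evalRingHom] at h2
    rw [h2]
    refine isLeftRegular_companionMatrix hn _ ?_
    simpa [h0] using hc.map _)
  refine ⟨M, hM, fun j => ?_⟩
  have hdd (r : ℕ) : DiffDiv (p : T) r (fun m => f (j + M * m)) := by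
    refine hper (fun i a => f (i + a)) (fun i => ?_) j r ⟨0, hn⟩
    have h2 := companionMatrix_map h (Polynomial.evalRingHom (i : T))
    simp only [Polynomial.coe_evalRingHom] at h2
    rw [h2]
    ext a
    exact companionMatrix_mulVec _ (hf i) a
  have hcoord (i) (r : ℕ) : (p : ℤ_[p]) ^ r ∣
      (fwdDiff 1)^[r] (fun m => B.repr (f (j + M * m)) i) 0 := by
    obtain ⟨z, hz⟩ := (hdd r).pow_dvd_fwdDiff_iter 0
    have h3 : (fwdDiff 1)^[r] (fun m => B.repr (f (j + M * m)) i) 0 =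
        B.repr ((fwdDiff 1)^[r] (fun m => f (j + M * m)) 0) i := by
      simp only [fwdDiff_iter_eq_sum_shift, map_sum, map_zsmul, Finsupp.coe_finsetSum,
        Finset.sum_apply, Finsupp.smul_apply]
    refine ⟨B.repr z i, ?_⟩
    rw [h3, hz, ← Nat.cast_pow, hcast, map_smul, Finsupp.smul_apply, smul_eq_mul, Nat.cast_pow]
  -- Zeros of `f` are common zeros of its coordinates, so one coordinate that is not identically
  -- zero already bounds them.
  by_cases hall : ∀ i m, B.repr (f (j + M * m)) i = 0
  · left
    exact fun m => B.ext_elem fun i => by simpa using hall i m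
  · right
    push Not at hall
    obtain ⟨i, m, hm⟩ := hall
    rcases finite_zeros_of_pow_dvd_fwdDiff hp3 _ (hcoord i) with h | h
    · exact absurd (h m) hm
    · exact h.subset fun m hm => by simp [show f (j + M * m) = 0 from hm]

/-! ### Embedding finitely generated domains `p`-adically -/

open Cardinal in
theorem PadicInt.continuum_le_cardinalMk (p : ℕ) [Fact p.Prime] : 𝔠 ≤ #ℤ_[p] := by
  have ho : IsOpen {x : ℚ_[p] | ‖x‖ ≤ 1} := by
    have := IsUltrametricDist.isOpen_closedBall (0 : ℚ_[p]) one_ne_zero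
    simpa [Metric.closedBall] using this
  have hne : {x : ℚ_[p] | ‖x‖ ≤ 1}.Nonempty := ⟨0, by simp⟩
  exact continuum_le_cardinal_of_isOpen ℚ_[p] ho hne

-- With finite transcendence degree over `ℤ`, the ring `ℤ_[p]` would be countable.
open Cardinal in
theorem PadicInt.infinite_of_isTranscendenceBasis {p : ℕ} [Fact p.Prime] {ι : Type}
    {x : ι → ℤ_[p]} (hx : IsTranscendenceBasis ℤ x) : Infinite ι := by
  by_contra hfin
  rw [not_infinite_iff_finite] at hfin
  have halg := hx.isAlgebraic
  have h1 : #(MvPolynomial ι ℤ) ≤ ℵ₀ := by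
    refine MvPolynomial.cardinalMk_le_max.trans ?_
    simp [Cardinal.mk_le_aleph0]
  rw [Cardinal.mk_congr hx.1.aevalEquiv.toEquiv] at h1
  have h2 := Algebra.IsAlgebraic.cardinalMk_le_max (Algebra.adjoin ℤ (Set.range x)) ℤ_[p]
  rw [max_eq_right h1] at h2
  exact absurd ((PadicInt.continuum_le_cardinalMk p).trans h2) (not_le.2 aleph0_lt_continuum)

/-- There are algebraically independent `p`-adic integers in prescribed residue classes. -/
theorem PadicInt.exists_algebraicIndependent (p : ℕ) [hp : Fact p.Prime] {ι : Type*} [Finite ι]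
    (a : ι → ℤ) : ∃ y : ι → ℤ_[p], AlgebraicIndependent ℤ y ∧
      ∀ i, (p : ℤ_[p]) ∣ y i - (a i : ℤ_[p]) := by
  obtain ⟨B, hB⟩ := exists_isTranscendenceBasis ℤ ℤ_[p]
  have := PadicInt.infinite_of_isTranscendenceBasis hB
  obtain ⟨n, ⟨e⟩⟩ := Finite.exists_equiv_fin ι
  let g : ι ↪ B := e.toEmbedding.trans (Fin.valEmbedding.trans (Infinite.natEmbedding B))
  have hind : AlgebraicIndependent ℤ (fun i => ((g i : B) : ℤ_[p])) := hB.1.comp g g.injective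
  have hpZ : (p : ℤ) ≠ 0 := by exact_mod_cast hp.out.ne_zero
  -- Replacing each element `g i` by `p g i + a i` fixes the residue and preserves independence.
  refine ⟨_, hind.polynomial_aeval_of_transcendental
    (f := fun i => Polynomial.C (p : ℤ) * Polynomial.X + Polynomial.C (a i)) fun i => ?_,
    fun i => ⟨(g i : B), by simp⟩⟩
  refine Polynomial.transcendental _ ?_ ?_
  · rw [Polynomial.natDegree_linear hpZ]; exact one_ne_zero
  · rw [Polynomial.leadingCoeff_linear hpZ]; exact mem_nonZeroDivisors_of_ne_zero hpZ

/-- A nonzero ideal of a domain algebraic over `R` pulls back to a nonzero ideal of `R`. -/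
theorem RingHom.injective_of_isAlgebraic {R A B : Type*} [CommRing R] [CommRing A] [IsDomain A]
    [CommRing B] [Algebra R A] [Algebra.IsAlgebraic R A] (φ : A →+* B)
    (h : Function.Injective (φ.comp (algebraMap R A))) : Function.Injective φ := by
  rw [injective_iff_map_eq_zero]
  intro x hx
  by_contra hx0
  refine Ideal.comap_ne_bot_of_algebraic_mem (R := R) hx0 (I := RingHom.ker φ) hx
    (Algebra.IsAlgebraic.isAlgebraic x) ?_
  rw [RingHom.comap_ker]
  exact (RingHom.injective_iff_ker_eq_bot _).1 h

theorem MvPolynomial.exists_eval_ne_zero {ι : Type*} {D : MvPolynomial ι ℤ} (hD : D ≠ 0) :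
    ∃ a : ι → ℤ, MvPolynomial.eval a D ≠ 0 := by
  by_contra! h
  exact hD (MvPolynomial.funext fun a => by simpa using h a)

theorem MvPolynomial.dvd_aeval_sub_eval {A ι : Type*} [CommRing A] {q : A} {y : ι → A} {a : ι → ℤ}
    (h : ∀ i, q ∣ y i - (a i : A)) (D : MvPolynomial ι ℤ) :
    q ∣ MvPolynomial.aeval y D - ((MvPolynomial.eval a D : ℤ) : A) := by
  induction D using MvPolynomial.induction_on with
  | C c => simp
  | add P Q hP hQ =>
    have := dvd_add hP hQ
    rw [map_add, map_add]
    push_cast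
    convert this using 1
    ring
  | mul_X P i hP =>
    have := dvd_add (hP.mul_right (y i)) ((h i).mul_left ((MvPolynomial.eval a P : ℤ) : A))
    rw [map_mul, map_mul, MvPolynomial.aeval_X, MvPolynomial.eval_X]
    push_cast
    convert this using 1
    ring

theorem PadicInt.isUnit_of_dvd_sub_intCast {p : ℕ} [hp : Fact p.Prime] {z : ℤ_[p]} {c : ℤ}
    (h : (p : ℤ_[p]) ∣ z - c) (hc : ¬ (p : ℤ) ∣ c) : IsUnit z := by
  rw [PadicInt.isUnit_iff]
  by_contra hz
  have hz' : ‖z‖ < 1 := lt_of_le_of_ne (PadicInt.norm_le_one z) hz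
  rw [PadicInt.norm_lt_one_iff_dvd] at hz'
  have := (dvd_sub_right hz').1 h
  exact hc (by rwa [← PadicInt.norm_lt_one_iff_dvd, PadicInt.norm_int_lt_one_iff_dvd] at this)

/-- The subalgebra generated over `ℤ_[p]` by finitely many integral elements of a field extension
of `ℚ_[p]` is a finite free `ℤ_[p]`-module. -/
theorem PadicInt.finite_and_free_adjoin {p : ℕ} [Fact p.Prime] {C : Type*} [Field C]
    [Algebra ℤ_[p] C] [FaithfulSMul ℤ_[p] C] {s : Set C} (hs : s.Finite)
    (hint : ∀ x ∈ s, IsIntegral ℤ_[p] x) :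
    Module.Finite ℤ_[p] (Algebra.adjoin ℤ_[p] s) ∧ Module.Free ℤ_[p] (Algebra.adjoin ℤ_[p] s) := by
  have hfin : Module.Finite ℤ_[p] (Algebra.adjoin ℤ_[p] s) :=
    Module.Finite.iff_fg.2 (fg_adjoin_of_finite hs hint)
  exact ⟨hfin, Module.free_of_finite_type_torsion_free'⟩

/-- A finitely generated domain of characteristic zero embeds, for some prime `p ≥ 3`, into a
`ℤ_[p]`-algebra that is free of finite rank as a module. -/
theorem exists_injective_ringHom_finite_free {A : Type*} [CommRing A] [IsDomain A] [CharZero A]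
    {S : Set A} (hS : S.Finite) (hgen : Algebra.adjoin ℤ S = ⊤) :
    ∃ (p : ℕ) (_ : Fact p.Prime) (T : Type) (_ : CommRing T) (_ : Algebra ℤ_[p] T),
      3 ≤ p ∧ Module.Finite ℤ_[p] T ∧ Module.Free ℤ_[p] T ∧
      ∃ φ : A →+* T, Function.Injective φ := by
  have halg : Algebra.IsAlgebraic (Algebra.adjoin ℤ S) A := by
    rw [hgen]
    exact ⟨fun x => isAlgebraic_algebraMap (⟨x, trivial⟩ : (⊤ : Subalgebra ℤ A))⟩
  obtain ⟨t, htS, ht⟩ := exists_isTranscendenceBasis_subset (R := ℤ) S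
  have : Finite t := hS.subset htS
  set R := Algebra.adjoin ℤ (Set.range (Subtype.val : t → A)) with hR
  have halgR : Algebra.IsAlgebraic R A := ht.isAlgebraic
  let e : MvPolynomial t ℤ ≃ₐ[ℤ] R := ht.1.aevalEquiv
  have hmul (s : A) : ∃ D : R, D ≠ 0 ∧ IsIntegral R (D • s) :=
    (halgR.isAlgebraic s).exists_integral_multiple
  choose D hD0 hDint using hmul
  -- A common denominator: `E` times any generator is integral over the polynomial ring `R`.
  set E : R := ∏ s ∈ hS.toFinset, D s with hE
  have hE0 : E ≠ 0 := Finset.prod_ne_zero_iff.2 fun s _ => hD0 s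
  have hEint (s : A) (hs : s ∈ S) : IsIntegral R (E • s) := by
    classical
    rw [hE, ← Finset.prod_erase_mul _ _ (hS.mem_toFinset.2 hs), mul_smul]
    exact (hDint s).smul _
  obtain ⟨a, ha⟩ := MvPolynomial.exists_eval_ne_zero
    (D := e.symm E) (by simpa using hE0)
  -- The prime exceeds the nonzero integer `E(a)`, hence does not divide it. Sending the variables
  -- to `y ≡ a` modulo `p` then makes `E` a unit of `ℤ_[p]`, so the generators become integral.
  obtain ⟨p, hpge, hpp⟩ := Nat.exists_infinite_primes
    ((MvPolynomial.eval a (e.symm E)).natAbs + 3)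
  have : Fact p.Prime := ⟨hpp⟩
  have hndvd : ¬ (p : ℤ) ∣ MvPolynomial.eval a (e.symm E) := fun h => by
    have := Nat.le_of_dvd (Int.natAbs_pos.2 ha) (Int.natCast_dvd.1 h)
    omega
  obtain ⟨y, hy, hya⟩ := PadicInt.exists_algebraicIndependent p a
  let C := AlgebraicClosure ℚ_[p]
  let ψ : R →+* ℤ_[p] := (MvPolynomial.aeval y : MvPolynomial t ℤ →ₐ[ℤ] ℤ_[p]).toRingHom.comp
    e.symm.toRingEquiv.toRingHom
  have hψ : Function.Injective ψ := Function.Injective.comp (g := MvPolynomial.aeval y) hy e.symm.injective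
  have hψE : IsUnit (ψ E) :=
    PadicInt.isUnit_of_dvd_sub_intCast (MvPolynomial.dvd_aeval_sub_eval hya (e.symm E)) hndvd
  have hC : Function.Injective (algebraMap ℤ_[p] C) := by
    rw [IsScalarTower.algebraMap_eq ℤ_[p] ℚ_[p] C]
    exact (algebraMap ℚ_[p] C).injective.comp (IsFractionRing.injective ℤ_[p] ℚ_[p])
  have : FaithfulSMul ℤ_[p] C := (faithfulSMul_iff_algebraMap_injective _ _).2 hC
  let : Algebra R C := ((algebraMap ℤ_[p] C).comp ψ).toAlgebra
  have hRC : algebraMap R C = (algebraMap ℤ_[p] C).comp ψ := rfl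
  have hRCinj : Function.Injective (algebraMap R C) := hC.comp hψ
  have : FaithfulSMul R C := (faithfulSMul_iff_algebraMap_injective _ _).2 hRCinj
  let φ : A →ₐ[R] C := IsAlgClosed.lift
  have hφ : Function.Injective φ := RingHom.injective_of_isAlgebraic (R := R) φ.toRingHom (by
    have : φ.toRingHom.comp (algebraMap R A) = algebraMap R C := φ.comp_algebraMap
    rwa [this])
  have hint (x : C) (hx : x ∈ φ '' S) : IsIntegral ℤ_[p] x := by
    obtain ⟨s, hs, rfl⟩ := hx
    obtain ⟨P, hPm, hP⟩ := (hEint s hs).map φ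
    have h1 : IsIntegral ℤ_[p] (φ (E • s)) := ⟨P.map ψ, hPm.map ψ, by
      rwa [Polynomial.eval₂_map, ← hRC]⟩
    obtain ⟨u, hu⟩ := hψE
    have h2 : φ s = (↑u⁻¹ : ℤ_[p]) • φ (E • s) := by
      rw [map_smul, Algebra.smul_def (R := ℤ_[p]), Algebra.smul_def, hRC, RingHom.comp_apply, ← hu,
        ← mul_assoc, ← map_mul, Units.inv_mul, map_one, one_mul]
    rw [h2]
    exact h1.smul _
  obtain ⟨hfin, hfree⟩ := PadicInt.finite_and_free_adjoin (hS.image φ) hint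
  refine ⟨p, inferInstance, Algebra.adjoin ℤ_[p] (φ '' S), inferInstance, inferInstance,
    by omega, hfin, hfree, ?_⟩
  have hmem (x : A) : φ x ∈ Algebra.adjoin ℤ_[p] (φ '' S) := by
    have hx : x ∈ Algebra.adjoin ℤ S := hgen ▸ Algebra.mem_top
    induction hx using Algebra.adjoin_induction with
    | mem x hx => exact Algebra.subset_adjoin ⟨x, hx, rfl⟩
    | algebraMap n => simp
    | add x y _ _ hx hy => rw [map_add]; exact add_mem hx hy
    | mul x y _ _ hx hy => rw [map_mul]; exact mul_mem hx hy
  exact ⟨φ.toRingHom.codRestrict (Algebra.adjoin ℤ_[p] (φ '' S)).toSubring hmem,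
    fun x y hxy => hφ (congrArg Subtype.val hxy)⟩

/-! ### Finite unions of arithmetic progressions -/

theorem IsFiniteUnionOfArithProgs.union {S S' : Set ℕ} (h : IsFiniteUnionOfArithProgs S)
    (h' : IsFiniteUnionOfArithProgs S') : IsFiniteUnionOfArithProgs (S ∪ S') := by
  obtain ⟨A, hA, hP, rfl⟩ := h
  obtain ⟨A', hA', hP', rfl⟩ := h'
  exact ⟨A ∪ A', hA.union hA', fun P hP'' => hP''.elim (hP P) (hP' P), (Set.sUnion_union _ _).symm⟩

theorem IsArithProg.isFiniteUnion {S : Set ℕ} (h : IsArithProg S) : IsFiniteUnionOfArithProgs S :=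
  ⟨{S}, Set.finite_singleton S, by simpa using h, by simp⟩

theorem Set.Finite.isFiniteUnionOfArithProgs {S : Set ℕ} (h : S.Finite) :
    IsFiniteUnionOfArithProgs S := by
  refine ⟨(fun i => {i}) '' S, h.image _, ?_, by simp⟩
  rintro _ ⟨i, _, rfl⟩
  exact ⟨i, 0, by ext m; simp⟩

theorem IsFiniteUnionOfArithProgs.biUnion {ι : Type*} (s : Finset ι) (S : ι → Set ℕ)
    (h : ∀ i ∈ s, IsFiniteUnionOfArithProgs (S i)) :
    IsFiniteUnionOfArithProgs (⋃ i ∈ s, S i) := by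
  classical
  induction s using Finset.induction_on with
  | empty => simpa using Set.finite_empty.isFiniteUnionOfArithProgs
  | insert i s _ ih =>
    rw [Finset.set_biUnion_insert]
    exact (h i (Finset.mem_insert_self i s)).union
      (ih fun j hj => h j (Finset.mem_insert_of_mem hj))

/-- A set that meets each residue class modulo `M`, from `i₀` on, in a finite set or in everything
is a finite union of arithmetic progressions. -/
theorem isFiniteUnionOfArithProgs_of_residue_classes {S : Set ℕ} (i₀ : ℕ) {M : ℕ} (hM : 0 < M)
    (h : ∀ j, (∀ m, i₀ + (j + M * m) ∈ S) ∨ {m | i₀ + (j + M * m) ∈ S}.Finite) :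
    IsFiniteUnionOfArithProgs S := by
  have hS : S = (S ∩ Set.Iio i₀) ∪
      ⋃ j ∈ Finset.range M, (fun m => i₀ + (j + M * m)) '' {m | i₀ + (j + M * m) ∈ S} := by
    ext i
    simp only [Set.mem_union, Set.mem_inter_iff, Set.mem_Iio, Set.mem_iUnion, Set.mem_image,
      Finset.mem_range, exists_prop]
    constructor
    · intro hi
      by_cases hlt : i < i₀
      · exact Or.inl ⟨hi, hlt⟩
      · have heq : i₀ + ((i - i₀) % M + M * ((i - i₀) / M)) = i := by
          rw [Nat.mod_add_div]; omega
        exact Or.inr ⟨(i - i₀) % M, Nat.mod_lt _ hM, (i - i₀) / M, by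
          rw [Set.mem_ofPred_eq, heq]; exact hi, heq⟩
    · rintro (⟨hi, _⟩ | ⟨j, _, m, hm, rfl⟩)
      · exact hi
      · exact hm
  rw [hS]
  refine ((Set.finite_Iio i₀).inter_of_right S).isFiniteUnionOfArithProgs.union
    (IsFiniteUnionOfArithProgs.biUnion _ _ fun j _ => ?_)
  rcases h j with h | h
  · refine IsArithProg.isFiniteUnion ⟨i₀ + j, M, ?_⟩
    ext i
    simp only [h, Set.mem_image]
    exact ⟨fun ⟨m, _, hm⟩ => ⟨m, by rw [← hm]; ring⟩, fun ⟨m, hm⟩ => ⟨m, trivial, by rw [hm]; ring⟩⟩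
  · exact (h.image _).isFiniteUnionOfArithProgs

/-! ### Descent from a field and conclusion -/

/-- Over a finitely generated domain of characteristic zero, the zeros of a solution of a linear
recurrence with polynomial coefficients and unit trailing coefficient are, along each residue
class modulo a suitable `M`, finite in number or everything. -/
theorem exists_period_zeros_of_finitely_generated {A : Type*} [CommRing A] [IsDomain A] [CharZero A]
    {S : Set A} (hS : S.Finite) (hgen : Algebra.adjoin ℤ S = ⊤) {n : ℕ} (hn : 0 < n)
    (h : Fin n → Polynomial A) {c : A} (hc : IsUnit c) (h0 : h ⟨0, hn⟩ = Polynomial.C c)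
    (f : ℕ → A)
    (hf : ∀ i : ℕ, f (i + n) + ∑ j : Fin n, (h j).eval (i : A) * f (i + (j : ℕ)) = 0) :
    ∃ M, 0 < M ∧ ∀ j, (∀ m, f (j + M * m) = 0) ∨ {m | f (j + M * m) = 0}.Finite := by
  obtain ⟨p, hp, T, _, _, hp3, _, _, φ, hφ⟩ := exists_injective_ringHom_finite_free hS hgen
  obtain ⟨M, hM, hz⟩ := exists_period_zeros hp3 hn (fun j => (h j).map φ) (hc.map φ)
    (by simp [h0]) (fun i => φ (f i)) (fun i => by
      have := congrArg φ (hf i)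
      simpa only [map_add, map_sum, map_mul, map_zero, ← Polynomial.eval₂_at_apply,
        ← Polynomial.eval_map, map_natCast] using this)
  exact ⟨M, hM, by simpa only [map_eq_zero_iff φ hφ] using hz⟩

theorem exists_period_zeros_of_field {k : Type*} [Field k] [CharZero k] {n : ℕ} (hn : 0 < n)
    (h : Fin n → Polynomial k) {c : k} (hc : c ≠ 0) (h0 : h ⟨0, hn⟩ = Polynomial.C c)
    (f : ℕ → k)
    (hf : ∀ i : ℕ, f (i + n) + ∑ j : Fin n, (h j).eval (i : k) * f (i + (j : ℕ)) = 0) :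
    ∃ M, 0 < M ∧ ∀ j, (∀ m, f (j + M * m) = 0) ∨ {m | f (j + M * m) = 0}.Finite := by
  -- Including `c⁻¹` keeps the trailing coefficient a unit in the subring; the other elements make
  -- it contain the whole sequence.
  set S : Set k := {c⁻¹} ∪ (f '' Set.Iio n) ∪ ⋃ j, ((h j).coeffs : Set k) with hS
  have hSfin : S.Finite := ((Set.finite_singleton _).union ((Set.finite_Iio n).image f)).union
    (Set.finite_iUnion fun j => (h j).coeffs.finite_toSet)
  let A := Algebra.adjoin ℤ S
  have hSA : S ⊆ A := Algebra.subset_adjoin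
  have hlift (j : Fin n) : ∃ H : Polynomial A, H.map (algebraMap A k) = h j := by
    refine (Polynomial.mem_lifts _).1 ((Polynomial.lifts_iff_coeff_lifts _).2 fun i => ?_)
    by_cases hi : (h j).coeff i = 0
    · exact ⟨0, by rw [hi, map_zero]⟩
    · exact ⟨⟨_, hSA (Or.inr (Set.mem_iUnion.2 ⟨j, Polynomial.coeff_mem_coeffs hi⟩))⟩, rfl⟩
  choose H hH using hlift
  have heval (j : Fin n) (i : ℕ) : (h j).eval (i : k) = ((H j).eval (i : A) : A) := by
    rw [← hH, Polynomial.eval_map, ← map_natCast (algebraMap A k), Polynomial.eval₂_at_apply]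
    rfl
  have hfA (i : ℕ) : f i ∈ A := by
    induction i using Nat.strong_induction_on with
    | _ i ih =>
      by_cases hi : i < n
      · exact hSA (Or.inl (Or.inr ⟨i, hi, rfl⟩))
      · obtain ⟨i, rfl⟩ : ∃ m, i = m + n := ⟨i - n, by omega⟩
        rw [eq_neg_of_add_eq_zero_left (hf i)]
        refine neg_mem (sum_mem fun j _ => mul_mem ?_ (ih _ (by have := j.isLt; omega)))
        rw [heval]
        exact Subtype.coe_prop _
  have hcA : c ∈ A := by
    refine hSA (Or.inr (Set.mem_iUnion.2 ⟨⟨0, hn⟩, ?_⟩))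
    have : c = (h ⟨0, hn⟩).coeff 0 := by simp [h0]
    rw [this]
    exact Polynomial.coeff_mem_coeffs (by rwa [← this])
  have hcinv : c⁻¹ ∈ A := hSA (Or.inl (Or.inl rfl))
  have hunit : IsUnit (⟨c, hcA⟩ : A) :=
    IsUnit.of_mul_eq_one ⟨c⁻¹, hcinv⟩ (Subtype.ext (mul_inv_cancel₀ hc))
  have hinj : Function.Injective (algebraMap A k) := Subtype.val_injective
  have hH0 : H ⟨0, hn⟩ = Polynomial.C ⟨c, hcA⟩ := by
    refine Polynomial.map_injective _ hinj ?_
    rw [hH, h0, Polynomial.map_C]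
    rfl
  obtain ⟨M, hM, hz⟩ := exists_period_zeros_of_finitely_generated
    (hSfin.preimage Subtype.val_injective.injOn) (Algebra.adjoin_adjoin_coe_preimage) hn H hunit
    hH0 (fun i => (⟨f i, hfA i⟩ : A)) (fun i => Subtype.ext (by
      have := hf i
      simp only [heval] at this
      push_cast
      exact this))
  refine ⟨M, hM, ?_⟩
  have hzero (i : ℕ) : (⟨f i, hfA i⟩ : A) = 0 ↔ f i = 0 := Subtype.ext_iff
  simpa only [hzero] using hz

theorem mainTheorem3 {k : Type*} [Field k] [CharZero k] (n : ℕ) (hn : 0 < n)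
    (h : Fin n → Polynomial k)
    (h_zero : ∃ c : k, c ≠ 0 ∧ h ⟨0, hn⟩ = Polynomial.C c)
    (f : ℕ → k) (hf : IsSequenceSolution h f) :
    IsFiniteUnionOfArithProgs {i : ℕ | f i = 0} := by
  obtain ⟨c, hc, h0⟩ := h_zero
  obtain ⟨i₀, hi₀⟩ := Filter.eventually_atTop.1 hf
  -- Translating by `i₀` makes the recurrence hold from index `0` and leaves the constant trailing
  -- coefficient unchanged.
  obtain ⟨M, hM, hz⟩ := exists_period_zeros_of_field hn
    (fun j => (h j).comp (Polynomial.C (i₀ : k) + Polynomial.X)) hc (by simp [h0])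
    (fun i => f (i₀ + i)) (fun i => by
      have := hi₀ (i₀ + i) (Nat.le_add_right _ _)
      simpa [Polynomial.eval_comp, add_assoc] using this)
  exact isFiniteUnionOfArithProgs_of_residue_classes i₀ hM hz
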